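/- Corollary 4.1. Let $1<\alpha<2$, $0<d<1-\frac1\alpha$ and $1\le p<\alpha$. Let $\{L_\alpha(t)\}_{t\in\mathbb R}$ be a symmetric $\alpha$-stable Lévy motion on a probability space $(\Omega,\mathcal F,\mathbb P)$, i.e. $L_\alpha(0)=0$ a.s., the increments are independent, and $\mathbb E\, e^{i\theta(L_\alpha(t)-L_\alpha(s))}=e^{-(t-s)|\theta|^\alpha}$ for all $s\le t$ and $\theta\in\mathbb R$. For $f\in L^\alpha(\mathbb R)$ let $\int f\,dL_\alpha$ denote the stable stochastic integral, i.e. the limit in probability of $\int\varphi_n\,dL_\alpha$ for step functions $\varphi_n\to f$ in $L^\alpha(\mathbb R)$, where $\int\sum_i a_i\mathbf 1_{(x_i,x_{i+1}]}\,dL_\alpha=\sum_i a_i(L_\alpha(x_{i+1})-L_\alpha(x_i))$. Let $g:\mathbb R\to\mathbb R$ be measurable with $g(t)=0$ for $t<0$ and $|g(t)|\le Ce^{-ct}$ for all $t$, for some constants $C,c>0$, and put $$(I_+^dg)(x)=\frac1{\Gamma(d)}\int_{-\infty}^x g(u)(x-u)^{d-1}\,du,\qquad Y_d(t)=\int_{-\infty}^t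 (I_+^dg)(t-x)\,dL_\alpha(x),\quad t\in\mathbb R .$$ Then $Y_d$ is well defined. Moreover, let $(t_j)_{j\ge1}$ be real sampling times that are bounded below, $t_j\ge a$ for all $j\ge 1$, and suppose that for some $\beta,K>0$ the limit $\lim_{j\to\infty}j^{-\beta}t_j$ exists in $\mathbb R$ and is at least $K$. Then, with $S_n=\sum_{j=1}^nY_d(t_j)$, we have $S_n/n\in L^p(\Omega,\mathbb P)$ for every $n\ge1$ and $$\frac{S_n}{n}\to0\quad\text{in }L^p(\Omega,\mathbb P)\text{ as }n\to\infty .$$ -/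

import Mathlib

open MeasureTheory ProbabilityTheory Filter Topology

namespace FIMA

/-- A (standard) symmetric `α`-stable Lévy motion indexed by the real line, i.e. the symmetric
`α`-stable process with independent increments and Lebesgue control measure: `L 0 = 0` almost
surely, the increments are independent, and for `s ≤ t` the increment `L t - L s` has the law
`S_α((t - s)^{1/α}, 0, 0)`, whose characteristic function is `θ ↦ exp (-(t - s) |θ|^α)`. -/
structure IsStableMotion {Ω : Type*} [MeasurableSpace Ω] (P : Measure Ω) (α : ℝ)
    (L : ℝ → Ω → ℝ) : Prop where
  measurable : ∀ t, Measurable (L t)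
  zero : ∀ᵐ ω ∂P, L 0 ω = 0
  indep : HasIndepIncrements L P
  charFun_increment : ∀ s t : ℝ, s ≤ t → ∀ θ : ℝ,
    charFun (P.map (fun ω => L t ω - L s ω)) θ = ((Real.exp (-((t - s) * |θ| ^ α)) : ℝ) : ℂ)

/-- The data of a step function `∑_{i < n} a_i 1_{(x_i, x_{i+1}]}` with finite knots
`x_0 ≤ x_1 ≤ ... ≤ x_n` (only the knots and coefficients up to `n` matter). -/
structure StepFunction where
  n : ℕ
  knot : ℕ → ℝ
  coef : ℕ → ℝ
  mono : Monotone knot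

/-- The function `∑_{i < n} a_i 1_{(x_i, x_{i+1}]}`. -/
noncomputable def StepFunction.toFun (φ : StepFunction) (x : ℝ) : ℝ :=
  ∑ i ∈ Finset.range φ.n,
    φ.coef i * (Set.Ioc (φ.knot i) (φ.knot (i + 1))).indicator (fun _ => (1 : ℝ)) x

/-- The elementary stochastic integral `∑_{i < n} a_i (L(x_{i+1}) - L(x_i))`. -/
noncomputable def StepFunction.integral {Ω : Type*} (φ : StepFunction) (L : ℝ → Ω → ℝ)
    (ω : Ω) : ℝ :=
  ∑ i ∈ Finset.range φ.n, φ.coef i * (L (φ.knot (i + 1)) ω - L (φ.knot i) ω)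

/-- `X` is (a version of) the stable stochastic integral `∫ f dL` of `f ∈ L^α(ℝ)`: the limit in
probability of the elementary integrals of step functions that converge to `f` in `L^α(ℝ)`. -/
def IsStableIntegral {Ω : Type*} [MeasurableSpace Ω] (P : Measure Ω) (α : ℝ)
    (L : ℝ → Ω → ℝ) (f : ℝ → ℝ) (X : Ω → ℝ) : Prop :=
  MemLp f (ENNReal.ofReal α) volume ∧
  ∃ φ : ℕ → StepFunction,
    Tendsto (fun n => eLpNorm (fun x => (φ n).toFun x - f x) (ENNReal.ofReal α) volume)
      atTop (𝓝 0) ∧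
    TendstoInMeasure P (fun n => (φ n).integral L) atTop X

/-- The left-sided Riemann–Liouville fractional integral
`(I_+^d g)(x) = Γ(d)⁻¹ ∫_{-∞}^x g(u) (x - u)^{d-1} du`. -/
noncomputable def leftFracIntegral (d : ℝ) (g : ℝ → ℝ) (x : ℝ) : ℝ :=
  (Real.Gamma d)⁻¹ * ∫ u in Set.Iio x, g u * (x - u) ^ (d - 1)

/-- A short-memory kernel with positive support: `g` is measurable, vanishes on the negative
half-line, and `|g(t)| ≤ C e^{-ct}` for some `C, c > 0`. -/
structure IsShortMemoryKernel (g : ℝ → ℝ) : Prop where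
  measurable : Measurable g
  eq_zero_of_neg : ∀ t < 0, g t = 0
  exp_bound : ∃ C c : ℝ, 0 < C ∧ 0 < c ∧ ∀ t, |g t| ≤ C * Real.exp (-(c * t))

/-- `Y` is (a version of) the fractionally integrated moving average stable process
`Y_d(t) = ∫_{-∞}^t (I_+^d g)(t - x) dL(x)`, `t ∈ ℝ`. -/
def IsFIMAProcess {Ω : Type*} [MeasurableSpace Ω] (P : Measure Ω) (α d : ℝ)
    (g : ℝ → ℝ) (L : ℝ → Ω → ℝ) (Y : ℝ → Ω → ℝ) : Prop :=
  ∀ t : ℝ, IsStableIntegral P α L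
    ((Set.Iic t).indicator (fun x => leftFracIntegral d g (t - x))) (Y t)

/-- The partial sums `S_n = ∑_{j=1}^n Y(t_j)`. -/
noncomputable def partialSum {Ω : Type*} (Y : ℝ → Ω → ℝ) (t : ℕ → ℝ) (n : ℕ) (ω : Ω) : ℝ :=
  ∑ j ∈ Finset.Icc 1 n, Y (t j) ω

end FIMA

namespace FIMA

/-! For `p < α` the stable integral is a bounded linear map from `L^α(ℝ)` to `L^p(Ω)`. Independence
of the increments makes the elementary integral of `φ` symmetric stable with scale `‖φ‖_α`, and such
a variable has `L^p` norm at most a constant times its scale. Density of step functions then gives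
both the existence of the integral and the bound `‖∫ f dL‖_p ≤ C ‖f‖_α`.

Put `h = 1_{[0,∞)} · I_+^d g`. By linearity `S_n / n` is the integral of `F_n(x) = n⁻¹ ∑ h(t_j -
x)`, so a probabilistic statement becomes the deterministic one that `h ∈ L^α` and `‖F_n‖_α → 0`.

The first holds because `h` is bounded and `O(x^(d-1))`, while `(d - 1) α < -1`. For the second,
averaging translates does not increase the `L^α` norm, so `h` may be replaced by a continuous `k` of
compact support. Since `t_j ∼ ℓ j^β` with `ℓ > 0`, even when `β < 1` and the times crowd together, a
window of fixed length contains only `o(n)` of `t_1, …, t_n` (`eventually_card_window_le`). Hence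
`sup |F_n| → 0`, the `L^1` norm stays below `‖k‖_1`, and interpolation finishes because `α > 1`. -/

/-! ### Moments of symmetric stable laws. -/

/-- Tail bound for a law whose characteristic function is `θ ↦ exp (-s |θ| ^ α)`. -/
lemma measureReal_lt_abs_le_of_charFun_eq {μ : Measure ℝ} [IsProbabilityMeasure μ] {α s r : ℝ}
    (hα : 0 < α) (hs : 0 ≤ s) (hr : 0 < r)
    (hμ : ∀ θ : ℝ, charFun μ θ = ((Real.exp (-(s * |θ| ^ α)) : ℝ) : ℂ)) :
    μ.real {x | r < |x|} ≤ 2 * 2 ^ α * s * r ^ (-α) := by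
  refine (measureReal_abs_gt_le_integral_charFun hr).trans ?_
  -- On an interval of length `4 / r` the integrand `1 - exp (-s|t|^α)` is at most `s|t|^α ≤ s
  -- (2/r)^α`.
  have h : ‖∫ t in (-2 * r⁻¹)..(2 * r⁻¹), 1 - charFun μ t‖
      ≤ (s * (2 * r⁻¹) ^ α) * |2 * r⁻¹ - -2 * r⁻¹| := by
    refine intervalIntegral.norm_integral_le_of_norm_le_const fun t ht ↦ ?_
    have hri : 0 < r⁻¹ := inv_pos.2 hr
    rw [Set.uIoc_of_le (by linarith)] at ht
    have habs : |t| ≤ 2 * r⁻¹ := abs_le.2 ⟨by linarith [ht.1], ht.2⟩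
    have hpow : |t| ^ α ≤ (2 * r⁻¹) ^ α := Real.rpow_le_rpow (abs_nonneg _) habs hα.le
    have hnn : 0 ≤ s * |t| ^ α := by positivity
    rw [hμ t, ← Complex.ofReal_one, ← Complex.ofReal_sub, Complex.norm_real, Real.norm_eq_abs,
      abs_of_nonneg (by simpa using hnn)]
    have := Real.add_one_le_exp (-(s * |t| ^ α))
    nlinarith [mul_le_mul_of_nonneg_left hpow hs]
  refine (mul_le_mul_of_nonneg_left h (by positivity)).trans (le_of_eq ?_)
  rw [abs_of_nonneg (by have : 0 < r⁻¹ := inv_pos.2 hr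
                        linarith),
    Real.mul_rpow (by norm_num) (by positivity), Real.inv_rpow hr.le, Real.rpow_neg hr.le]
  field_simp
  ring

/-- Moments of order `p < α` of the laws with characteristic function `θ ↦ exp (-s |θ| ^ α)`,
`s ≤ 1`, are uniformly bounded. -/
lemma exists_eLpNorm_id_le_of_charFun_eq {α p : ℝ} (hp : 0 < p) (hpα : p < α) :
    ∃ C : NNReal, ∀ (μ : Measure ℝ) [IsProbabilityMeasure μ] (s : ℝ), 0 ≤ s → s ≤ 1 →
      (∀ θ : ℝ, charFun μ θ = ((Real.exp (-(s * |θ| ^ α)) : ℝ) : ℂ)) →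
      eLpNorm (fun x : ℝ ↦ x) (ENNReal.ofReal p) μ ≤ C := by
  have hα : 0 < α := hp.trans hpα
  -- Layer-cake bound for the `p`-th moment: the tail is at most `1` on `(0, 1]`, which needs `p >
  -- 0`, and `O(t^(-α))` beyond, which needs `p < α`.
  set D : ENNReal := ENNReal.ofReal p * ((∫⁻ t in Set.Ioc (0 : ℝ) 1, ENNReal.ofReal (t ^ (p - 1))) +
      ∫⁻ t in Set.Ioi (1 : ℝ), ENNReal.ofReal (2 * 2 ^ α * t ^ (p - 1 - α))) with hD
  have hDtop : D ≠ ⊤ := by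
    refine ENNReal.mul_ne_top ENNReal.ofReal_ne_top (ENNReal.add_ne_top.2 ⟨?_, ?_⟩)
    · have : IntegrableOn (fun t : ℝ ↦ t ^ (p - 1)) (Set.Ioc 0 1) :=
        (intervalIntegrable_iff_integrableOn_Ioc_of_le zero_le_one).1
          (intervalIntegral.intervalIntegrable_rpow' (by linarith))
      exact this.lintegral_lt_top.ne
    · have : IntegrableOn (fun t : ℝ ↦ 2 * 2 ^ α * t ^ (p - 1 - α)) (Set.Ioi 1) :=
        (integrableOn_Ioi_rpow_of_lt (by linarith) one_pos).const_mul _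
      exact this.lintegral_lt_top.ne
  refine ⟨(D ^ (1 / p)).toNNReal, fun μ _ s hs hs1 hμ ↦ ?_⟩
  rw [ENNReal.coe_toNNReal (ENNReal.rpow_ne_top_of_nonneg (by positivity) hDtop),
    eLpNorm_eq_lintegral_rpow_enorm_toReal (by simpa using hp) ENNReal.ofReal_ne_top,
    ENNReal.toReal_ofReal hp.le]
  refine ENNReal.rpow_le_rpow ?_ (by positivity)
  have hlay := lintegral_rpow_eq_lintegral_meas_lt_mul μ (f := fun x : ℝ ↦ |x|)
    (ae_of_all _ fun x ↦ abs_nonneg x) (by fun_prop) hp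
  calc ∫⁻ x, ‖x‖ₑ ^ p ∂μ = ∫⁻ x, ENNReal.ofReal (|x| ^ p) ∂μ := by
        refine lintegral_congr fun x ↦ ?_
        rw [← ENNReal.ofReal_rpow_of_nonneg (abs_nonneg _) hp.le, Real.enorm_eq_ofReal_abs]
    _ = _ := hlay
    _ ≤ D := by
      rw [hD]
      gcongr
      rw [← Set.Ioc_union_Ioi_eq_Ioi (zero_le_one' ℝ),
        lintegral_union measurableSet_Ioi (Set.Ioc_disjoint_Ioi le_rfl)]
      gcongr ?_ + ?_
      · refine setLIntegral_mono' measurableSet_Ioc fun t _ ↦ ?_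
        exact (mul_le_mul_left prob_le_one _).trans (one_mul _).le
      · refine setLIntegral_mono' measurableSet_Ioi fun t ht ↦ ?_
        have ht0 : 0 < t := zero_lt_one.trans ht
        have := measureReal_lt_abs_le_of_charFun_eq hα hs ht0 hμ
        rw [← ofReal_measureReal, ← ENNReal.ofReal_mul measureReal_nonneg]
        refine ENNReal.ofReal_le_ofReal ?_
        rw [sub_eq_add_neg (p - 1) α, Real.rpow_add ht0, mul_comm (t ^ (p - 1)), ← mul_assoc]
        refine mul_le_mul_of_nonneg_right (this.trans ?_) (by positivity)
        have : 0 ≤ 2 * (2 : ℝ) ^ α * t ^ (-α) := by positivity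
        nlinarith

/-- A symmetric `α`-stable variable of scale at most `σ` has `L^p` norm at most `C σ`. -/
lemma exists_eLpNorm_le_of_charFun_map_eq {Ω : Type*} [MeasurableSpace Ω] (P : Measure Ω)
    [IsProbabilityMeasure P] {α p : ℝ} (hp : 0 < p) (hpα : p < α) :
    ∃ C : NNReal, ∀ (X : Ω → ℝ) (s σ : ℝ), Measurable X → 0 ≤ s → 0 < σ → s ≤ σ ^ α →
      (∀ θ : ℝ, charFun (P.map X) θ = ((Real.exp (-(s * |θ| ^ α)) : ℝ) : ℂ)) →
      eLpNorm X (ENNReal.ofReal p) P ≤ C * ENNReal.ofReal σ := by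
  obtain ⟨C, hC⟩ := exists_eLpNorm_id_le_of_charFun_eq hp hpα
  refine ⟨C, fun X s σ hX hs hσ hsσ hchar ↦ ?_⟩
  have hsc : Measurable fun ω ↦ σ⁻¹ * X ω := hX.const_mul _
  have hprob : IsProbabilityMeasure (P.map fun ω ↦ σ⁻¹ * X ω) :=
    Measure.isProbabilityMeasure_map hsc.aemeasurable
  have hσα : 0 < σ ^ α := Real.rpow_pos_of_pos hσ α
  -- Dividing by `σ` turns `s` into `s / σ^α ≤ 1`, the range of the uniform bound.
  have key := hC (P.map fun ω ↦ σ⁻¹ * X ω) (s / σ ^ α) (by positivity) ((div_le_one hσα).2 hsσ)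
    fun θ ↦ by
      have hmap : P.map (fun ω ↦ σ⁻¹ * X ω) = (P.map X).map (fun x ↦ σ⁻¹ * x) := by
        rw [Measure.map_map (by fun_prop) hX]; rfl
      rw [hmap, charFun_map_mul, hchar, abs_mul, abs_of_pos (inv_pos.2 hσ),
        Real.mul_rpow (by positivity) (abs_nonneg _), Real.inv_rpow hσ.le]
      congr 3
      ring
  rw [eLpNorm_map_measure (by fun_prop) hsc.aemeasurable] at key
  have hXe : X = σ • fun ω ↦ σ⁻¹ * X ω := by
    funext ω
    simp [hσ.ne']
  rw [hXe, eLpNorm_const_smul, Real.enorm_eq_ofReal hσ.le, mul_comm]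
  gcongr
  exact key

/-- A symmetric `α`-stable variable with scale parameter `s ^ (1 / α)` has `L^p` norm at most
`C s ^ (1 / α)`. -/
lemma exists_eLpNorm_le_scale {Ω : Type*} [MeasurableSpace Ω] (P : Measure Ω)
    [IsProbabilityMeasure P] {α p : ℝ} (hp : 0 < p) (hpα : p < α) :
    ∃ C : NNReal, ∀ (X : Ω → ℝ) (s : ℝ), Measurable X → 0 ≤ s →
      (∀ θ : ℝ, charFun (P.map X) θ = ((Real.exp (-(s * |θ| ^ α)) : ℝ) : ℂ)) →
      eLpNorm X (ENNReal.ofReal p) P ≤ C * ENNReal.ofReal (s ^ (1 / α)) := by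
  obtain ⟨C, hC⟩ := exists_eLpNorm_le_of_charFun_map_eq P hp hpα
  have hα : 0 < α := hp.trans hpα
  refine ⟨C, fun X s hX hs hchar ↦ ?_⟩
  -- The degenerate case `s = 0` would force `σ = 0`; taking `σ = s^(1/α) + δ` and letting `δ → 0`
  -- covers it.
  have hlim : Tendsto (fun δ : ℝ ↦ C * ENNReal.ofReal (s ^ (1 / α) + δ)) (𝓝[>] 0)
      (𝓝 (C * ENNReal.ofReal (s ^ (1 / α)))) := by
    refine ENNReal.Tendsto.const_mul ?_ (Or.inr ENNReal.coe_ne_top)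
    refine ENNReal.tendsto_ofReal ?_
    have : Tendsto (fun δ : ℝ ↦ s ^ (1 / α) + δ) (𝓝 0) (𝓝 (s ^ (1 / α) + 0)) :=
      tendsto_const_nhds.add tendsto_id
    simpa using this.mono_left nhdsWithin_le_nhds
  refine ge_of_tendsto hlim ?_
  filter_upwards [self_mem_nhdsWithin] with δ hδ
  have hδ : 0 < δ := hδ
  have hs' : 0 ≤ s ^ (1 / α) := by positivity
  refine hC X s _ hX hs (by linarith) ?_ hchar
  calc s = (s ^ (1 / α)) ^ α := by rw [← Real.rpow_mul hs, one_div_mul_cancel hα.ne', Real.rpow_one]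
    _ ≤ _ := Real.rpow_le_rpow hs' (by linarith) hα.le

/-! ### Step functions: common refinements and linearity. -/

/-- The sum `∑ a_i (G(x_{i+1}) - G(x_i))` of the weighted increments of `G`. -/
noncomputable def StepFunction.incrementSum (φ : StepFunction) (G : ℝ → ℝ) : ℝ :=
  ∑ i ∈ Finset.range φ.n, φ.coef i * (G (φ.knot (i + 1)) - G (φ.knot i))

lemma StepFunction.integral_eq_incrementSum {Ω : Type*} (φ : StepFunction) (L : ℝ → Ω → ℝ)
    (ω : Ω) : φ.integral L ω = φ.incrementSum fun s ↦ L s ω := rfl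

/-- The indicator of `(u, v]` is the increment from `u` to `v` of `s ↦ 1_{x ≤ s}`. The function and
its elementary integral are thus the same expression in different `G`, so one identity valid for all
`G` gives linearity of both. -/
lemma StepFunction.toFun_eq_incrementSum (φ : StepFunction) (x : ℝ) :
    φ.toFun x = φ.incrementSum fun s ↦ if x ≤ s then 1 else 0 := by
  refine Finset.sum_congr rfl fun i _ ↦ ?_
  have h := φ.mono (Nat.le_succ i)
  simp only [Nat.succ_eq_add_one] at h
  congr 1
  simp only [Set.indicator_apply, Set.mem_Ioc]
  split_ifs <;> first | (exfalso; grind) | norm_num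

/-- The points of a finite set are among the values of a monotone sequence of knots. -/
lemma exists_monotone_enumeration (S : Finset ℝ) :
    ∃ (w : ℕ → ℝ) (m : ℕ), Monotone w ∧ ∀ s ∈ S, ∃ j ≤ m, w j = s := by
  rcases h : S.card with _ | m
  · exact ⟨fun _ ↦ 0, 0, monotone_const, by simp [Finset.card_eq_zero.1 h]⟩
  -- Clamping the index at `m` keeps the sequence constant, hence monotone, past the largest point.
  · refine ⟨fun i ↦ S.orderEmbOfFin h ⟨min i m, by omega⟩, m, fun i j hij ↦ ?_, fun s hs ↦ ?_⟩
    · refine (S.orderEmbOfFin h).monotone ?_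
      simp only [Fin.mk_le_mk]
      omega
    · have : s ∈ Set.range (S.orderEmbOfFin h) := by rwa [Finset.range_orderEmbOfFin]
      obtain ⟨k, rfl⟩ := this
      refine ⟨k, by omega, ?_⟩
      exact congrArg (S.orderEmbOfFin h) (Fin.ext (min_eq_left (by omega)))

/-- A step function may be rewritten on any sequence of knots that contains its own knots. -/
lemma StepFunction.exists_coef (φ : StepFunction) (w : ℕ → ℝ) (m : ℕ)
    (hw : ∀ i ≤ φ.n, ∃ j ≤ m, w j = φ.knot i) :
    ∃ b : ℕ → ℝ, ∀ G : ℝ → ℝ,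
      φ.incrementSum G = ∑ l ∈ Finset.range m, b l * (G (w (l + 1)) - G (w l)) := by
  have hw' : ∀ i, ∃ j, i ≤ φ.n → j ≤ m ∧ w j = φ.knot i := fun i ↦ by
    by_cases hi : i ≤ φ.n
    · obtain ⟨j, hj⟩ := hw i hi
      exact ⟨j, fun _ ↦ hj⟩
    · exact ⟨0, fun h ↦ absurd h hi⟩
  choose j hj using hw'
  have tele : ∀ (G : ℝ → ℝ) k, k ≤ m → G (w k) =
      G (w 0) + ∑ l ∈ Finset.range m, (if l < k then 1 else 0) * (G (w (l + 1)) - G (w l)) := by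
    intro G k hk
    have h1 : ∑ l ∈ Finset.range m, (if l < k then (1 : ℝ) else 0) * (G (w (l + 1)) - G (w l))
        = ∑ l ∈ Finset.range k, (G (w (l + 1)) - G (w l)) := by
      simp only [ite_mul, one_mul, zero_mul]
      rw [← Finset.sum_filter]
      congr 1
      ext l
      simp only [Finset.mem_filter, Finset.mem_range]
      omega
    rw [h1, Finset.sum_range_sub (fun l ↦ G (w l))]
    ring
  -- Each old increment is a difference of two telescoping sums. The signed difference of indicators
  -- requires no order between `j i` and `j (i + 1)`.
  refine ⟨fun l ↦ ∑ i ∈ Finset.range φ.n,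
    φ.coef i * ((if l < j (i + 1) then 1 else 0) - if l < j i then 1 else 0), fun G ↦ ?_⟩
  simp_rw [Finset.sum_mul]
  rw [Finset.sum_comm]
  refine Finset.sum_congr rfl fun i hi ↦ ?_
  rw [Finset.mem_range] at hi
  obtain ⟨h1, h2⟩ := hj i hi.le
  obtain ⟨h3, h4⟩ := hj (i + 1) hi
  rw [← h2, ← h4, tele G _ h1, tele G _ h3, add_sub_add_left_eq_sub, ← Finset.sum_sub_distrib,
    Finset.mul_sum]
  exact Finset.sum_congr rfl fun l _ ↦ by ring

/-- Linear combinations of step functions are step functions, compatibly with the elementary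
integrals. -/
lemma StepFunction.exists_incrementSum_eq (φ ψ : StepFunction) (a b : ℝ) :
    ∃ χ : StepFunction, ∀ G : ℝ → ℝ,
      χ.incrementSum G = a * φ.incrementSum G + b * ψ.incrementSum G := by
  obtain ⟨w, m, hw, hS⟩ := exists_monotone_enumeration
    ((Finset.range (φ.n + 1)).image φ.knot ∪ (Finset.range (ψ.n + 1)).image ψ.knot)
  obtain ⟨u, hu⟩ := φ.exists_coef w m fun i hi ↦ hS _ (Finset.mem_union_left _
    (Finset.mem_image_of_mem _ (Finset.mem_range.2 (by omega))))
  obtain ⟨v, hv⟩ := ψ.exists_coef w m fun i hi ↦ hS _ (Finset.mem_union_right _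
    (Finset.mem_image_of_mem _ (Finset.mem_range.2 (by omega))))
  refine ⟨⟨m, w, fun l ↦ a * u l + b * v l, hw⟩, fun G ↦ ?_⟩
  rw [hu, hv, Finset.mul_sum, Finset.mul_sum, ← Finset.sum_add_distrib]
  exact Finset.sum_congr rfl fun l _ ↦ by ring

lemma StepFunction.measurable_toFun (φ : StepFunction) : Measurable φ.toFun :=
  Finset.measurable_sum _ fun _ _ ↦
    (measurable_const.indicator measurableSet_Ioc).const_mul _

lemma StepFunction.measurable_integral {Ω : Type*} [MeasurableSpace Ω] (φ : StepFunction)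
    {L : ℝ → Ω → ℝ} (hL : ∀ t, Measurable (L t)) : Measurable (φ.integral L) :=
  Finset.measurable_sum _ fun _ _ ↦ ((hL _).sub (hL _)).const_mul _

/-! ### Scale of an elementary integral and its `L^p` bound. -/

/-- The `α`-th power of the `L^α` norm of a step function. -/
noncomputable def StepFunction.scale (φ : StepFunction) (α : ℝ) : ℝ :=
  ∑ i ∈ Finset.range φ.n, |φ.coef i| ^ α * (φ.knot (i + 1) - φ.knot i)

lemma StepFunction.scale_nonneg (φ : StepFunction) (α : ℝ) : 0 ≤ φ.scale α :=
  Finset.sum_nonneg fun i _ ↦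
    mul_nonneg (by positivity) (sub_nonneg.2 (φ.mono (Nat.le_succ i)))

/-- The cells are disjoint, so at most one term is nonzero and the power passes through the sum. -/
lemma StepFunction.enorm_toFun_rpow (φ : StepFunction) {α : ℝ} (hα : 0 < α) (x : ℝ) :
    ‖φ.toFun x‖ₑ ^ α = ∑ i ∈ Finset.range φ.n,
      (Set.Ioc (φ.knot i) (φ.knot (i + 1))).indicator
        (fun _ ↦ ENNReal.ofReal (|φ.coef i| ^ α)) x := by
  have hdisj := φ.mono.pairwise_disjoint_on_Ioc_succ
  by_cases h : ∃ i ∈ Finset.range φ.n, x ∈ Set.Ioc (φ.knot i) (φ.knot (i + 1))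
  · obtain ⟨i, hi, hx⟩ := h
    have hne : ∀ k, k ≠ i → x ∉ Set.Ioc (φ.knot k) (φ.knot (k + 1)) := fun k hk hxk ↦
      Set.disjoint_left.1 (hdisj hk) hxk hx
    rw [StepFunction.toFun, Finset.sum_eq_single i, Finset.sum_eq_single i,
      Set.indicator_of_mem hx, Set.indicator_of_mem hx, mul_one, Real.enorm_eq_ofReal_abs,
      ENNReal.ofReal_rpow_of_nonneg (abs_nonneg _) hα.le]
    · exact fun k _ hk ↦ Set.indicator_of_notMem (hne k hk) _
    · exact fun hi' ↦ absurd hi hi'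
    · exact fun k _ hk ↦ by rw [Set.indicator_of_notMem (hne k hk), mul_zero]
    · exact fun hi' ↦ absurd hi hi'
  · push Not at h
    rw [StepFunction.toFun, Finset.sum_eq_zero, Finset.sum_eq_zero, enorm_zero,
      ENNReal.zero_rpow_of_pos hα]
    · exact fun i hi ↦ Set.indicator_of_notMem (h i hi) _
    · exact fun i hi ↦ by rw [Set.indicator_of_notMem (h i hi), mul_zero]

lemma StepFunction.eLpNorm_toFun (φ : StepFunction) {α : ℝ} (hα : 0 < α) :
    eLpNorm φ.toFun (ENNReal.ofReal α) volume = ENNReal.ofReal (φ.scale α ^ (1 / α)) := by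
  rw [eLpNorm_eq_lintegral_rpow_enorm_toReal (by simpa using hα) ENNReal.ofReal_ne_top,
    ENNReal.toReal_ofReal hα.le,
    ← ENNReal.ofReal_rpow_of_nonneg (φ.scale_nonneg α) (by positivity)]
  congr 1
  simp_rw [φ.enorm_toFun_rpow hα]
  rw [lintegral_finsetSum _ fun i _ ↦ measurable_const.indicator measurableSet_Ioc,
    StepFunction.scale, ENNReal.ofReal_sum_of_nonneg fun i _ ↦
    mul_nonneg (by positivity) (sub_nonneg.2 (φ.mono (Nat.le_succ i)))]
  refine Finset.sum_congr rfl fun i _ ↦ ?_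
  rw [lintegral_indicator_const measurableSet_Ioc, Real.volume_Ioc,
    ENNReal.ofReal_mul (by positivity)]

/-- The elementary integral of `φ` is symmetric `α`-stable with scale `‖φ‖_α`. -/
lemma IsStableMotion.charFun_integral {Ω : Type*} [MeasurableSpace Ω] {P : Measure Ω}
    {α : ℝ} {L : ℝ → Ω → ℝ} (hL : IsStableMotion P α L)
    (φ : StepFunction) (θ : ℝ) :
    charFun (P.map (φ.integral L)) θ = ((Real.exp (-(φ.scale α * |θ| ^ α)) : ℝ) : ℂ) := by
  have hind := (hL.indep.nat φ.mono).comp (fun i x ↦ φ.coef i * x) fun i ↦ by fun_prop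
  have hm : ∀ i, Measurable fun ω ↦ L (φ.knot (i + 1)) ω - L (φ.knot i) ω := fun i ↦
    (hL.measurable _).sub (hL.measurable _)
  have h := iIndepFun.charFun_map_fun_finsetSum_eq_prod (s := Finset.range φ.n)
    (fun i _ ↦ ((hm i).const_mul (φ.coef i)).aemeasurable) (hind.restrict _)
  have h' := congrFun h θ
  refine h'.trans ?_
  rw [Finset.prod_apply, StepFunction.scale, Finset.sum_mul, ← Finset.sum_neg_distrib,
    Real.exp_sum, Complex.ofReal_prod]
  refine Finset.prod_congr rfl fun i _ ↦ ?_
  have hmap : P.map (fun ω ↦ φ.coef i * (L (φ.knot (i + 1)) ω - L (φ.knot i) ω)) =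
      (P.map fun ω ↦ L (φ.knot (i + 1)) ω - L (φ.knot i) ω).map (fun x ↦ φ.coef i * x) := by
    rw [Measure.map_map (by fun_prop) (hm i)]; rfl
  rw [hmap, charFun_map_mul, hL.charFun_increment _ _ (φ.mono (Nat.le_succ i)), abs_mul,
    Real.mul_rpow (abs_nonneg _) (abs_nonneg _)]
  congr 3
  simp only [Nat.succ_eq_add_one]
  ring

/-- The elementary integral is a bounded map from `L^α(ℝ)` to `L^p(Ω)`. -/
lemma IsStableMotion.exists_eLpNorm_integral_le {Ω : Type*} [MeasurableSpace Ω] {P : Measure Ω}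
    [IsProbabilityMeasure P] {α p : ℝ} {L : ℝ → Ω → ℝ} (hL : IsStableMotion P α L) (hp : 0 < p)
    (hpα : p < α) :
    ∃ C : NNReal, ∀ φ : StepFunction, eLpNorm (φ.integral L) (ENNReal.ofReal p) P ≤
      C * eLpNorm φ.toFun (ENNReal.ofReal α) volume := by
  obtain ⟨C, hC⟩ := exists_eLpNorm_le_scale P hp hpα
  refine ⟨C, fun φ ↦ ?_⟩
  rw [φ.eLpNorm_toFun (hp.trans hpα)]
  exact hC _ _ (φ.measurable_integral hL.measurable) (φ.scale_nonneg α) (hL.charFun_integral φ)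

/-- On a common refinement the difference is again a step function, so boundedness becomes a
Lipschitz estimate. -/
lemma IsStableMotion.exists_eLpNorm_integral_sub_le {Ω : Type*} [MeasurableSpace Ω]
    {P : Measure Ω} [IsProbabilityMeasure P] {α p : ℝ} {L : ℝ → Ω → ℝ}
    (hL : IsStableMotion P α L) (hp : 0 < p) (hpα : p < α) :
    ∃ C : NNReal, ∀ φ ψ : StepFunction,
      eLpNorm (φ.integral L - ψ.integral L) (ENNReal.ofReal p) P ≤
      C * eLpNorm (φ.toFun - ψ.toFun) (ENNReal.ofReal α) volume := by
  obtain ⟨C, hC⟩ := hL.exists_eLpNorm_integral_le hp hpα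
  refine ⟨C, fun φ ψ ↦ ?_⟩
  obtain ⟨χ, hχ⟩ := φ.exists_incrementSum_eq ψ 1 (-1)
  have h1 : φ.integral L - ψ.integral L = χ.integral L := by
    funext ω
    simp only [Pi.sub_apply, StepFunction.integral_eq_incrementSum, hχ]
    ring
  have h2 : φ.toFun - ψ.toFun = χ.toFun := by
    funext x
    simp only [Pi.sub_apply, StepFunction.toFun_eq_incrementSum, hχ]
    ring
  rw [h1, h2]
  exact hC χ

/-! ### Density of step functions and existence of the integral. -/

/-- A continuous function that vanishes off a bounded interval is uniformly close to a step
function that vanishes off the same interval. -/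
lemma exists_stepFunction_abs_sub_le {k : ℝ → ℝ} (hk : UniformContinuous k) {M : ℝ} (hM : 0 < M)
    (hkM : ∀ x, x ∉ Set.Ioc (-M) M → k x = 0) {η : ℝ} (hη : 0 < η) :
    ∃ φ : StepFunction, ∀ x,
      |φ.toFun x - k x| ≤ (Set.Ioc (-M) M).indicator (fun _ ↦ η) x := by
  obtain ⟨δ, hδ, hkδ⟩ := Metric.uniformContinuous_iff.1 hk η hη
  obtain ⟨N, hN⟩ := exists_nat_gt (2 * M / δ)
  have hN0 : (0 : ℝ) < N := lt_of_le_of_lt (by positivity) hN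
  set h : ℝ := 2 * M / N with hh
  have hh0 : 0 < h := by positivity
  have hhδ : h < δ := by
    rw [hh, div_lt_iff₀ hN0]
    rw [div_lt_iff₀ hδ] at hN
    linarith
  have hNh : N * h = 2 * M := by rw [hh]; field_simp
  have hmono : Monotone fun i : ℕ ↦ -M + i * h := fun i j hij ↦ by
    have : (i : ℝ) ≤ j := by exact_mod_cast hij
    simp only
    nlinarith
  -- On each cell of length `h < δ` take the value of `k` at the right endpoint.
  refine ⟨⟨N, fun i ↦ -M + i * h, fun i ↦ k (-M + (i + 1 : ℕ) * h), hmono⟩, fun x ↦ ?_⟩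
  by_cases hx : x ∈ Set.Ioc (-M) M
  · rw [Set.indicator_of_mem hx]
    obtain ⟨i, hi⟩ : ∃ i, ⌈(x + M) / h⌉₊ = i + 1 :=
      Nat.exists_eq_succ_of_ne_zero (Nat.ceil_pos.2 (div_pos (by linarith [hx.1]) hh0)).ne'
    have h1 : (x + M) / h ≤ (i + 1 : ℕ) := hi ▸ Nat.le_ceil _
    have h2 : (i : ℝ) < (x + M) / h := Nat.lt_ceil.1 (by omega)
    rw [div_le_iff₀ hh0] at h1
    rw [lt_div_iff₀ hh0] at h2
    have hiN : i < N := by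
      have : (i : ℝ) * h < N * h := by linarith [hx.2]
      exact_mod_cast lt_of_mul_lt_mul_right this hh0.le
    have hxi : x ∈ Set.Ioc (-M + i * h) (-M + (i + 1 : ℕ) * h) :=
      ⟨by linarith, by linarith⟩
    rw [StepFunction.toFun, Finset.sum_eq_single i]
    · simp only
      rw [Set.indicator_of_mem hxi, mul_one, ← Real.dist_eq]
      refine (hkδ ?_).le
      rw [Real.dist_eq, abs_of_nonneg (by linarith)]
      push_cast at h1 ⊢
      linarith
    · intro l _ hl
      have hd := Set.disjoint_left.1 (hmono.pairwise_disjoint_on_Ioc_succ hl)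
      rw [Set.indicator_of_notMem, mul_zero]
      exact fun hxl ↦ hd hxl hxi
    · exact fun hi' ↦ absurd (Finset.mem_range.2 hiN) hi'
  · rw [Set.indicator_of_notMem hx, hkM x hx, StepFunction.toFun, Finset.sum_eq_zero]
    · simp
    · intro l hl
      have hlN : ((l : ℝ) + 1) ≤ N := by exact_mod_cast Finset.mem_range.1 hl
      rw [Set.indicator_of_notMem, mul_zero]
      simp only
      intro hxl
      refine hx ⟨?_, hxl.2.trans ?_⟩
      · have : (0 : ℝ) ≤ l * h := by positivity
        linarith [hxl.1]
      · push_cast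
        nlinarith

/-- Step functions are dense in `L^α(ℝ)`. -/
lemma exists_stepFunction_eLpNorm_sub_le {α : ℝ} (hα : 1 ≤ α) {f : ℝ → ℝ}
    (hf : MemLp f (ENNReal.ofReal α) volume) {ε : ENNReal} (hε : ε ≠ 0) :
    ∃ φ : StepFunction, eLpNorm (φ.toFun - f) (ENNReal.ofReal α) volume ≤ ε := by
  have hα0 : 0 < α := by linarith
  obtain ⟨k, hksupp, hkf, hkc, hkm⟩ := hf.exists_hasCompactSupport_eLpNorm_sub_le
    ENNReal.ofReal_ne_top (ENNReal.half_pos hε).ne'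
  obtain ⟨M, hM0, hM⟩ := hksupp.isCompact.isBounded.exists_pos_norm_lt
  have hkM : ∀ x, x ∉ Set.Ioc (-M) M → k x = 0 := fun x hx ↦ by
    refine image_eq_zero_of_notMem_tsupport fun hxs ↦ hx ?_
    have := abs_lt.1 (hM x hxs)
    exact ⟨this.1, this.2.le⟩
  obtain ⟨η, hη, hηε⟩ : ∃ η : ℝ, 0 < η ∧
      ‖η‖ₑ * volume (Set.Ioc (-M) M) ^ (1 / α) ≤ ε / 2 := by
    have hlim : Tendsto (fun η : ℝ ↦ ‖η‖ₑ * volume (Set.Ioc (-M) M) ^ (1 / α)) (𝓝[>] 0)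
        (𝓝 (‖(0 : ℝ)‖ₑ * volume (Set.Ioc (-M) M) ^ (1 / α))) := by
      refine ENNReal.Tendsto.mul_const ?_ (Or.inr ?_)
      · exact (continuous_enorm.tendsto 0).mono_left nhdsWithin_le_nhds
      · exact ENNReal.rpow_ne_top_of_nonneg (by positivity) (by simp)
    rw [enorm_zero, zero_mul] at hlim
    obtain ⟨η, h1, h2⟩ := (((tendsto_order.1 hlim).2 _ (ENNReal.half_pos hε)).and
      self_mem_nhdsWithin).exists
    exact ⟨η, h2, h1.le⟩
  obtain ⟨φ, hφ⟩ := exists_stepFunction_abs_sub_le (hksupp.uniformContinuous_of_continuous hkc)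
    hM0 hkM hη
  refine ⟨φ, ?_⟩
  have hφk : eLpNorm (φ.toFun - k) (ENNReal.ofReal α) volume ≤ ε / 2 := by
    refine (eLpNorm_mono_real hφ).trans ?_
    rw [eLpNorm_indicator_const measurableSet_Ioc (by simpa using hα0) ENNReal.ofReal_ne_top,
      ENNReal.toReal_ofReal hα0.le]
    exact hηε
  have hsplit : φ.toFun - f = (φ.toFun - k) - (f - k) := by abel
  rw [hsplit, ← ENNReal.add_halves ε]
  refine (eLpNorm_sub_le (φ.measurable_toFun.aestronglyMeasurable.sub hkm.1) (hf.1.sub hkm.1)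
    (by simpa using hα)).trans (add_le_add hφk hkf)

/-- The stable stochastic integral exists for every integrand in `L^α(ℝ)`. -/
lemma IsStableMotion.exists_isStableIntegral {Ω : Type*} [MeasurableSpace Ω] {P : Measure Ω}
    [IsProbabilityMeasure P] {α : ℝ} {L : ℝ → Ω → ℝ} (hL : IsStableMotion P α L) (hα : 1 < α)
    {f : ℝ → ℝ} (hf : MemLp f (ENNReal.ofReal α) volume) :
    ∃ X : Ω → ℝ, IsStableIntegral P α L f X := by
  have hε : ∀ n : ℕ, (2⁻¹ : ENNReal) ^ n ≠ 0 := fun n ↦ pow_ne_zero _ (by simp)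
  choose φ hφ using fun n ↦ exists_stepFunction_eLpNorm_sub_le hα.le hf (hε n)
  obtain ⟨C₁, hC₁⟩ := hL.exists_eLpNorm_integral_le one_pos hα
  obtain ⟨C, hC⟩ := hL.exists_eLpNorm_integral_sub_le one_pos hα
  rw [ENNReal.ofReal_one] at hC hC₁
  have hm : ∀ n, AEStronglyMeasurable ((φ n).toFun - f) volume := fun n ↦
    (φ n).measurable_toFun.aestronglyMeasurable.sub hf.1
  have hmem : ∀ n, MemLp ((φ n).integral L) 1 P := fun n ↦ by
    refine ⟨((φ n).measurable_integral hL.measurable).aestronglyMeasurable, ?_⟩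
    refine (hC₁ (φ n)).trans_lt (ENNReal.mul_lt_top ENNReal.coe_lt_top ?_)
    rw [(φ n).eLpNorm_toFun (by linarith)]
    exact ENNReal.ofReal_lt_top
  -- The factor `2` comes from the triangle inequality through `f`; the `+ 1` makes the Cauchy
  -- estimate strict even when `C = 0`.
  have hB : ∑' N : ℕ, ((C * 2 + 1) * 2⁻¹ ^ N : ENNReal) ≠ ⊤ := by
    rw [ENNReal.tsum_mul_left, ENNReal.tsum_geometric]
    refine ENNReal.mul_ne_top (by finiteness) ?_
    rw [ENNReal.one_sub_inv_two, inv_inv]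
    exact ENNReal.ofNat_ne_top
  have hcauchy : ∀ N n m : ℕ, N ≤ n → N ≤ m →
      eLpNorm ((φ n).integral L - (φ m).integral L) 1 P < (C * 2 + 1) * 2⁻¹ ^ N := by
    intro N n m hn hm'
    have hle : ∀ n, N ≤ n →
        eLpNorm ((φ n).toFun - f) (ENNReal.ofReal α) volume ≤ 2⁻¹ ^ N := fun n hn ↦
      (hφ n).trans (pow_le_pow_right_of_le_one' (by simp) hn)
    have h1 : eLpNorm ((φ n).toFun - (φ m).toFun) (ENNReal.ofReal α) volume ≤ 2 * 2⁻¹ ^ N := by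
      have hsplit : (φ n).toFun - (φ m).toFun = ((φ n).toFun - f) - ((φ m).toFun - f) := by abel
      rw [hsplit, two_mul]
      exact (eLpNorm_sub_le (hm n) (hm m) (by simpa using hα.le)).trans
        (add_le_add (hle n hn) (hle m hm'))
    refine ((hC _ _).trans (mul_le_mul_right h1 _)).trans_lt ?_
    rw [← mul_assoc]
    refine ENNReal.mul_lt_mul_left (hε N) (by finiteness) ?_
    exact ENNReal.lt_add_right (by finiteness) one_ne_zero
  obtain ⟨X, hX, hlim⟩ := Lp.cauchy_complete_eLpNorm le_rfl hmem hB hcauchy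
  refine ⟨X, hf, φ, ?_, tendstoInMeasure_of_tendsto_eLpNorm one_ne_zero
    (fun n ↦ (hmem n).1) hX.1 hlim⟩
  refine tendsto_of_tendsto_of_tendsto_of_le_of_le tendsto_const_nhds
    (ENNReal.tendsto_pow_atTop_nhds_zero_of_lt_one ?_) (fun _ ↦ zero_le) hφ
  exact ENNReal.inv_lt_one.2 (by norm_num)

/-! ### Stable integrals as `L^p` limits. -/

/-- `X` is simultaneously approximated in `L^p(Ω)` by elementary integrals of step functions that
approximate `f` in `L^α(ℝ)`. -/
structure IsStableLpLimit {Ω : Type*} [MeasurableSpace Ω] (P : Measure Ω) (α p : ℝ)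
    (L : ℝ → Ω → ℝ) (f : ℝ → ℝ) (X : Ω → ℝ) : Prop where
  memLp : MemLp f (ENNReal.ofReal α) volume
  aestronglyMeasurable : AEStronglyMeasurable X P
  exists_approx : ∀ ε : ENNReal, ε ≠ 0 → ∃ φ : StepFunction,
    eLpNorm (φ.toFun - f) (ENNReal.ofReal α) volume ≤ ε ∧
    eLpNorm (φ.integral L - X) (ENNReal.ofReal p) P ≤ ε

/-- Elementary integrals that converge in probability to a stable integral also converge to it in
`L^p`, `1 ≤ p < α`. -/
lemma IsStableIntegral.isStableLpLimit {Ω : Type*} [MeasurableSpace Ω] {P : Measure Ω}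
    [IsProbabilityMeasure P] {α p : ℝ} {L : ℝ → Ω → ℝ} (hL : IsStableMotion P α L) (hp : 1 ≤ p)
    (hpα : p < α) {f : ℝ → ℝ} {X : Ω → ℝ} (hX : IsStableIntegral P α L f X) :
    IsStableLpLimit P α p L f X := by
  obtain ⟨hf, φ, hφ, hφX⟩ := hX
  obtain ⟨C, hC⟩ := hL.exists_eLpNorm_integral_sub_le (by linarith) hpα
  have hmeas : ∀ n, AEStronglyMeasurable ((φ n).integral L) P := fun n ↦
    ((φ n).measurable_integral hL.measurable).aestronglyMeasurable
  have hm : ∀ n, AEStronglyMeasurable ((φ n).toFun - f) volume := fun n ↦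
    (φ n).measurable_toFun.aestronglyMeasurable.sub hf.1
  refine ⟨hf, hφX.aestronglyMeasurable hmeas, fun ε hε ↦ ?_⟩
  -- Fatou along an almost surely convergent subsequence upgrades convergence in probability: the
  -- distance from the `n`-th integral to `X` is at most `C * e n`.
  obtain ⟨ns, hns, hae⟩ := hφX.exists_seq_tendsto_ae
  set e : ℕ → ENNReal := fun n ↦ eLpNorm ((φ n).toFun - f) (ENNReal.ofReal α) volume with he
  have he0 : Tendsto e atTop (𝓝 0) := hφ
  have hle : ∀ n, eLpNorm ((φ n).integral L - X) (ENNReal.ofReal p) P ≤ C * e n := fun n ↦ by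
    have hlim : Tendsto (fun k ↦ C * (e n + e (ns k))) atTop (𝓝 (C * (e n + 0))) :=
      ENNReal.Tendsto.const_mul (tendsto_const_nhds.add (he0.comp hns.tendsto_atTop))
        (Or.inr ENNReal.coe_ne_top)
    rw [add_zero] at hlim
    rw [← hlim.liminf_eq]
    refine (Lp.eLpNorm_lim_le_liminf_eLpNorm (f := fun k ↦ (φ n).integral L - (φ (ns k)).integral L)
      (fun k ↦ (hmeas n).sub (hmeas _)) _ ?_).trans (liminf_le_liminf (Eventually.of_forall
      fun k ↦ ?_))
    · filter_upwards [hae] with ω hω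
      exact tendsto_const_nhds.sub hω
    · refine (hC _ _).trans (mul_le_mul_right ?_ _)
      have hsplit : (φ n).toFun - (φ (ns k)).toFun =
        ((φ n).toFun - f) - ((φ (ns k)).toFun - f) := by abel
      rw [hsplit]
      exact eLpNorm_sub_le (hm n) (hm _) (by simpa using (hp.trans hpα.le))
  have hlim : Tendsto (fun n ↦ C * e n) atTop (𝓝 0) := by
    have := ENNReal.Tendsto.const_mul (a := (C : ENNReal)) he0 (Or.inr ENNReal.coe_ne_top)
    rwa [mul_zero] at this
  obtain ⟨n, h1, h2⟩ := (((tendsto_order.1 he0).2 ε hε.bot_lt).and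
    ((tendsto_order.1 hlim).2 ε hε.bot_lt)).exists
  exact ⟨φ n, h1.le, (hle n).trans h2.le⟩

lemma IsStableLpLimit.zero {Ω : Type*} [MeasurableSpace Ω] (P : Measure Ω) (α p : ℝ)
    (L : ℝ → Ω → ℝ) : IsStableLpLimit P α p L 0 0 := by
  refine ⟨MemLp.zero', aestronglyMeasurable_zero, fun ε _ ↦ ⟨⟨0, 0, 0, monotone_const⟩, ?_, ?_⟩⟩
  · have : StepFunction.toFun ⟨0, 0, 0, monotone_const⟩ - 0 = 0 := by
      funext x
      simp [StepFunction.toFun]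
    simp [this]
  · have : StepFunction.integral ⟨0, 0, 0, monotone_const⟩ L - 0 = 0 := by
      funext x
      simp [StepFunction.integral]
    simp [this]

lemma IsStableLpLimit.linear_combination {Ω : Type*} [MeasurableSpace Ω] {P : Measure Ω}
    {α p : ℝ} {L : ℝ → Ω → ℝ} (hL : IsStableMotion P α L) (hp : 1 ≤ p) (hα : 1 ≤ α)
    {f g : ℝ → ℝ} {X Y : Ω → ℝ} (hX : IsStableLpLimit P α p L f X)
    (hY : IsStableLpLimit P α p L g Y) (a b : ℝ) :
    IsStableLpLimit P α p L (a • f + b • g) (a • X + b • Y) := by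
  refine ⟨(hX.memLp.const_smul a).add (hY.memLp.const_smul b),
    (hX.aestronglyMeasurable.const_smul a).add (hY.aestronglyMeasurable.const_smul b),
    fun ε hε ↦ ?_⟩
  obtain ⟨δ, hδ, hδε⟩ : ∃ δ : ENNReal, δ ≠ 0 ∧ ‖a‖ₑ * δ + ‖b‖ₑ * δ ≤ ε := by
    -- If `a = b = 0` this is `⊤`, which is harmless since `0 * ⊤ = 0`.
    refine ⟨ε / (‖a‖ₑ + ‖b‖ₑ), ?_, ?_⟩
    · simp [ENNReal.div_eq_zero_iff, hε]
    · rw [← add_mul]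
      exact ENNReal.mul_div_le
  obtain ⟨φ, hφ1, hφ2⟩ := hX.exists_approx δ hδ
  obtain ⟨ψ, hψ1, hψ2⟩ := hY.exists_approx δ hδ
  obtain ⟨χ, hχ⟩ := φ.exists_incrementSum_eq ψ a b
  refine ⟨χ, ?_, ?_⟩
  · have : χ.toFun - (a • f + b • g) = a • (φ.toFun - f) + b • (ψ.toFun - g) := by
      funext x
      simp only [Pi.sub_apply, Pi.add_apply, Pi.smul_apply, smul_eq_mul,
        StepFunction.toFun_eq_incrementSum, hχ]
      ring
    rw [this]
    refine (eLpNorm_add_le ((φ.measurable_toFun.aestronglyMeasurable.sub hX.memLp.1).const_smul a)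
      ((ψ.measurable_toFun.aestronglyMeasurable.sub hY.memLp.1).const_smul b)
      (by simpa using hα)).trans (le_trans ?_ hδε)
    rw [eLpNorm_const_smul, eLpNorm_const_smul]
    gcongr
  · have : χ.integral L - (a • X + b • Y) =
        a • (φ.integral L - X) + b • (ψ.integral L - Y) := by
      funext x
      simp only [Pi.sub_apply, Pi.add_apply, Pi.smul_apply, smul_eq_mul,
        StepFunction.integral_eq_incrementSum, hχ]
      ring
    rw [this]
    refine (eLpNorm_add_le
      (((φ.measurable_integral hL.measurable).aestronglyMeasurable.sub
        hX.aestronglyMeasurable).const_smul a)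
      (((ψ.measurable_integral hL.measurable).aestronglyMeasurable.sub
        hY.aestronglyMeasurable).const_smul b)
      (by simpa using hp)).trans (le_trans ?_ hδε)
    rw [eLpNorm_const_smul, eLpNorm_const_smul]
    gcongr

/-- The `L^p` norm of a stable integral is bounded by the `L^α` norm of the integrand. -/
lemma IsStableMotion.exists_eLpNorm_le_of_isStableLpLimit {Ω : Type*} [MeasurableSpace Ω]
    {P : Measure Ω} [IsProbabilityMeasure P] {α p : ℝ} {L : ℝ → Ω → ℝ}
    (hL : IsStableMotion P α L) (hp : 1 ≤ p) (hpα : p < α) :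
    ∃ C : NNReal, ∀ (f : ℝ → ℝ) (X : Ω → ℝ), IsStableLpLimit P α p L f X →
      eLpNorm X (ENNReal.ofReal p) P ≤ C * eLpNorm f (ENNReal.ofReal α) volume := by
  obtain ⟨C, hC⟩ := hL.exists_eLpNorm_integral_le (by linarith) hpα
  refine ⟨C, fun f X hX ↦ ?_⟩
  set F := eLpNorm f (ENNReal.ofReal α) volume
  have hlim : Tendsto (fun ε : ENNReal ↦ C * (ε + F) + ε) (𝓝[>] 0) (𝓝 (C * (0 + F) + 0)) := by
    have hid : Tendsto (fun ε : ENNReal ↦ ε) (𝓝[>] 0) (𝓝 0) := nhdsWithin_le_nhds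
    exact (ENNReal.Tendsto.const_mul (hid.add tendsto_const_nhds)
      (Or.inr ENNReal.coe_ne_top)).add hid
  rw [zero_add, add_zero] at hlim
  refine ge_of_tendsto hlim ?_
  filter_upwards [self_mem_nhdsWithin] with ε hε
  obtain ⟨φ, h1, h2⟩ := hX.exists_approx ε (ne_of_gt hε)
  have hmφ := (φ.measurable_integral hL.measurable).aestronglyMeasurable (μ := P)
  have hφ : eLpNorm φ.toFun (ENNReal.ofReal α) volume ≤ ε + F := by
    have hsplit : φ.toFun = (φ.toFun - f) + f := by abel
    rw [hsplit]
    exact (eLpNorm_add_le (φ.measurable_toFun.aestronglyMeasurable.sub hX.memLp.1) hX.memLp.1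
      (by simpa using (hp.trans hpα.le))).trans (add_le_add h1 le_rfl)
  have hsplit : X = φ.integral L - (φ.integral L - X) := by abel
  rw [hsplit]
  refine (eLpNorm_sub_le hmφ (hmφ.sub hX.aestronglyMeasurable) (by simpa using hp)).trans ?_
  exact add_le_add ((hC φ).trans (mul_le_mul_right hφ _)) h2

/-! ### Size and integrability of the fractional kernel. -/

lemma measurable_leftFracIntegral (d : ℝ) {g : ℝ → ℝ} (hg : Measurable g) :
    Measurable (leftFracIntegral d g) := by
  have h : Measurable fun q : ℝ × ℝ ↦
      ({q : ℝ × ℝ | q.2 < q.1}).indicator (fun q ↦ g q.2 * (q.1 - q.2) ^ (d - 1)) q :=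
    Measurable.indicator (by fun_prop) (measurableSet_lt measurable_snd measurable_fst)
  have h2 := (h.stronglyMeasurable.integral_prod_right' (ν := volume)).measurable
  have h3 : leftFracIntegral d g = fun x ↦ (Real.Gamma d)⁻¹ * ∫ u,
      ({q : ℝ × ℝ | q.2 < q.1}).indicator (fun q ↦ g q.2 * (q.1 - q.2) ^ (d - 1)) (x, u) := by
    funext x
    rw [leftFracIntegral, ← integral_indicator measurableSet_Iio]
    rfl
  rw [h3]
  exact h2.const_mul _

/-- The fractional integrals of `u ↦ exp (-c u)` on the half-line are bounded. -/
lemma exists_lintegral_exp_mul_rpow_le {c d : ℝ} (hc : 0 < c) (hd : 0 < d) (hd1 : d < 1) :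
    ∃ M : NNReal, ∀ x : ℝ,
      ∫⁻ u in Set.Ico 0 x, ENNReal.ofReal (Real.exp (-(c * u)) * (x - u) ^ (d - 1)) ≤ M := by
  set A : ENNReal := ∫⁻ u in Set.Ici (0 : ℝ), ENNReal.ofReal (Real.exp (-(c * u)))
  set B : ENNReal := ∫⁻ v : ℝ, (Set.Ioc (0 : ℝ) 1).indicator
    (fun v ↦ ENNReal.ofReal (v ^ (d - 1))) v
  have hA : A ≠ ⊤ := by
    have : IntegrableOn (fun u : ℝ ↦ Real.exp (-(c * u))) (Set.Ici 0) := by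
      simpa only [neg_mul] using (integrableOn_Ici_iff_integrableOn_Ioi).2
        (exp_neg_integrableOn_Ioi 0 hc)
    exact this.lintegral_lt_top.ne
  have hB : B ≠ ⊤ := by
    have : IntegrableOn (fun t : ℝ ↦ t ^ (d - 1)) (Set.Ioc 0 1) :=
      (intervalIntegrable_iff_integrableOn_Ioc_of_le zero_le_one).1
        (intervalIntegral.intervalIntegrable_rpow' (by linarith))
    have h2 := this.lintegral_lt_top.ne
    rwa [← lintegral_indicator measurableSet_Ioc] at h2
  refine ⟨(A + B).toNNReal, fun x ↦ ?_⟩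
  rw [ENNReal.coe_toNNReal (ENNReal.add_ne_top.2 ⟨hA, hB⟩)]
  have hm : Measurable fun u : ℝ ↦ ENNReal.ofReal (Real.exp (-(c * u))) := by fun_prop
  calc ∫⁻ u in Set.Ico 0 x, ENNReal.ofReal (Real.exp (-(c * u)) * (x - u) ^ (d - 1))
      ≤ ∫⁻ u in Set.Ico 0 x, (ENNReal.ofReal (Real.exp (-(c * u))) +
        (Set.Ioc (0 : ℝ) 1).indicator (fun v ↦ ENNReal.ofReal (v ^ (d - 1))) (x - u)) := by
        refine setLIntegral_mono' measurableSet_Ico fun u hu ↦ ?_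
        have hxu : 0 < x - u := by linarith [hu.2]
        -- Near the singularity drop the exponential; away from it drop the power, which is at most
        -- `1`.
        by_cases h1 : x - u ≤ 1
        · rw [Set.indicator_of_mem (show x - u ∈ Set.Ioc (0 : ℝ) 1 from ⟨hxu, h1⟩)]
          refine le_add_left (ENNReal.ofReal_le_ofReal ?_)
          refine mul_le_of_le_one_left (by positivity) (Real.exp_le_one_iff.2 ?_)
          have := mul_nonneg hc.le hu.1
          linarith
        · refine le_add_right (ENNReal.ofReal_le_ofReal ?_)
          refine mul_le_of_le_one_right (by positivity) ?_
          exact Real.rpow_le_one_of_one_le_of_nonpos (by linarith) (by linarith)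
    _ = (∫⁻ u in Set.Ico 0 x, ENNReal.ofReal (Real.exp (-(c * u)))) +
        ∫⁻ u in Set.Ico 0 x,
          (Set.Ioc (0 : ℝ) 1).indicator (fun v ↦ ENNReal.ofReal (v ^ (d - 1))) (x - u) :=
        lintegral_add_left hm _
    _ ≤ A + ∫⁻ u, (Set.Ioc (0 : ℝ) 1).indicator (fun v ↦ ENNReal.ofReal (v ^ (d - 1))) (x - u) :=
        add_le_add (lintegral_mono_set Set.Ico_subset_Ici_self) (setLIntegral_le_lintegral _ _)
    _ = A + B := by
        rw [lintegral_sub_left_eq_self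
          (fun v ↦ (Set.Ioc (0 : ℝ) 1).indicator (fun v ↦ ENNReal.ofReal (v ^ (d - 1))) v) x]

/-- The fractional integral of order `d` of `u ↦ exp (-c u)` decays like `x ^ (d - 1)`. -/
lemma exists_rpow_mul_lintegral_exp_mul_rpow_le {c d : ℝ} (hc : 0 < c) (hd : 0 < d) (hd1 : d < 1) :
    ∃ M : NNReal, ∀ x : ℝ, ENNReal.ofReal (x ^ (1 - d)) *
      ∫⁻ u in Set.Ico 0 x, ENNReal.ofReal (Real.exp (-(c * u)) * (x - u) ^ (d - 1)) ≤ M := by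
  obtain ⟨M, hM⟩ := exists_lintegral_exp_mul_rpow_le (half_pos hc) hd hd1
  set A : ENNReal := ∫⁻ u in Set.Ici (0 : ℝ), ENNReal.ofReal (Real.exp (-(c * u)))
  have hA : A ≠ ⊤ := by
    have : IntegrableOn (fun u : ℝ ↦ Real.exp (-(c * u))) (Set.Ici 0) := by
      simpa only [neg_mul] using (integrableOn_Ici_iff_integrableOn_Ioi).2
        (exp_neg_integrableOn_Ioi 0 hc)
    exact this.lintegral_lt_top.ne
  -- Chosen so that `1 + u ≤ D (1 + c u / 2) ≤ D exp (c u / 2)`.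
  set D : ℝ := 1 + 2 / c with hD
  have hD0 : 0 < D := by positivity
  have hu_le : ∀ u : ℝ, 0 ≤ u → u ^ (1 - d) ≤ D * Real.exp (c / 2 * u) := fun u hu ↦ by
    have h1 : u ^ (1 - d) ≤ 1 + u := by
      rcases le_total u 1 with h | h
      · have := Real.rpow_le_one hu h (by linarith : 0 ≤ 1 - d)
        linarith
      · have := Real.rpow_le_rpow_of_exponent_le h (by linarith : 1 - d ≤ 1)
        rw [Real.rpow_one] at this
        linarith
    have h2 := Real.add_one_le_exp (c / 2 * u)
    have h3 : D * (c / 2 * u + 1) = c / 2 * u + u + 1 + 2 / c := by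
      rw [hD]; field_simp; ring
    have h4 : 0 ≤ c / 2 * u := by positivity
    have h5 : 0 < 2 / c := by positivity
    nlinarith [mul_le_mul_of_nonneg_left h2 hD0.le]
  refine ⟨(A + ENNReal.ofReal D * M).toNNReal, fun x ↦ ?_⟩
  rw [ENNReal.coe_toNNReal (ENNReal.add_ne_top.2 ⟨hA, by finiteness⟩)]
  have hm : Measurable fun u : ℝ ↦ ENNReal.ofReal (Real.exp (-(c * u))) := by fun_prop
  rw [← lintegral_const_mul _ (by fun_prop)]
  calc ∫⁻ u in Set.Ico 0 x, ENNReal.ofReal (x ^ (1 - d)) *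
        ENNReal.ofReal (Real.exp (-(c * u)) * (x - u) ^ (d - 1))
      ≤ ∫⁻ u in Set.Ico 0 x, (ENNReal.ofReal (Real.exp (-(c * u))) +
          ENNReal.ofReal D * ENNReal.ofReal (Real.exp (-(c / 2 * u)) * (x - u) ^ (d - 1))) := by
        refine setLIntegral_mono' measurableSet_Ico fun u hu ↦ ?_
        have hxu : 0 < x - u := by linarith [hu.2]
        rw [← ENNReal.ofReal_mul (Real.rpow_nonneg (hu.1.trans hu.2.le) _),
          ← ENNReal.ofReal_mul hD0.le, ← ENNReal.ofReal_add (by positivity) (by positivity)]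
        refine ENNReal.ofReal_le_ofReal ?_
        -- Subadditivity of the power: `(x - u)^(1-d)` cancels the kernel, and `u^(1-d)` costs half
        -- of the exponential rate.
        have h1 : x ^ (1 - d) ≤ (x - u) ^ (1 - d) + u ^ (1 - d) := by
          have := Real.rpow_add_le_add_rpow hxu.le hu.1 (by linarith : 0 ≤ 1 - d) (by linarith)
          rwa [sub_add_cancel] at this
        have h2 : (x - u) ^ (1 - d) * (x - u) ^ (d - 1) = 1 := by
          rw [← Real.rpow_add hxu]
          norm_num
        have h3 : Real.exp (c / 2 * u) * Real.exp (-(c * u)) = Real.exp (-(c / 2 * u)) := by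
          rw [← Real.exp_add]
          congr 1
          ring
        set E := Real.exp (-(c * u))
        set q := (x - u) ^ (d - 1)
        have hq : 0 ≤ q := by positivity
        have hE : 0 ≤ E := by positivity
        calc x ^ (1 - d) * (E * q) ≤ ((x - u) ^ (1 - d) + D * Real.exp (c / 2 * u)) * (E * q) :=
              mul_le_mul_of_nonneg_right (by linarith [hu_le u hu.1]) (by positivity)
          _ = E * ((x - u) ^ (1 - d) * q) + D * ((Real.exp (c / 2 * u) * E) * q) := by ring
          _ = _ := by rw [h2, h3, mul_one]
    _ = (∫⁻ u in Set.Ico 0 x, ENNReal.ofReal (Real.exp (-(c * u)))) +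
        ENNReal.ofReal D * ∫⁻ u in Set.Ico 0 x,
          ENNReal.ofReal (Real.exp (-(c / 2 * u)) * (x - u) ^ (d - 1)) := by
        rw [lintegral_add_left hm, lintegral_const_mul _ (by fun_prop)]
    _ ≤ A + ENNReal.ofReal D * M :=
        add_le_add (lintegral_mono_set Set.Ico_subset_Ici_self) (mul_le_mul_right (hM x) _)

/-- The fractional integral of a short-memory kernel is bounded and decays like `x ^ (d - 1)`. -/
lemma IsShortMemoryKernel.exists_abs_leftFracIntegral_le {g : ℝ → ℝ} (hg : IsShortMemoryKernel g)
    {d : ℝ} (hd : 0 < d) (hd1 : d < 1) :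
    ∃ M : ℝ, 0 ≤ M ∧ (∀ x, |leftFracIntegral d g x| ≤ M) ∧
      ∀ x, 0 < x → |leftFracIntegral d g x| ≤ M * x ^ (d - 1) := by
  obtain ⟨C, c, hC, hc, hbound⟩ := hg.exp_bound
  obtain ⟨M₁, hM₁⟩ := exists_lintegral_exp_mul_rpow_le hc hd hd1
  obtain ⟨M₂, hM₂⟩ := exists_rpow_mul_lintegral_exp_mul_rpow_le hc hd hd1
  have hΓ : 0 < (Real.Gamma d)⁻¹ := inv_pos.2 (Real.Gamma_pos_of_pos hd)
  have key : ∀ x, ENNReal.ofReal |leftFracIntegral d g x| ≤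
      ENNReal.ofReal ((Real.Gamma d)⁻¹ * C) *
      ∫⁻ u in Set.Ico 0 x, ENNReal.ofReal (Real.exp (-(c * u)) * (x - u) ^ (d - 1)) := fun x ↦ by
    rw [leftFracIntegral, abs_mul, abs_of_pos hΓ, ENNReal.ofReal_mul hΓ.le,
      ENNReal.ofReal_mul hΓ.le, mul_assoc]
    refine mul_le_mul_right ?_ _
    rw [← Real.enorm_eq_ofReal_abs]
    refine (enorm_integral_le_lintegral_enorm _).trans ?_
    rw [← lintegral_const_mul _ (by fun_prop), ← lintegral_indicator measurableSet_Iio,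
      ← lintegral_indicator measurableSet_Ico]
    refine lintegral_mono fun u ↦ ?_
    by_cases hux : u < x
    · rw [Set.indicator_of_mem (show u ∈ Set.Iio x from hux)]
      rcases lt_or_ge u 0 with hu | hu
      · simp [hg.eq_zero_of_neg u hu]
      · rw [Set.indicator_of_mem (show u ∈ Set.Ico 0 x from ⟨hu, hux⟩),
          ← ENNReal.ofReal_mul hC.le, Real.enorm_eq_ofReal_abs, abs_mul,
          abs_of_nonneg (Real.rpow_nonneg (sub_pos.2 hux).le _), ← mul_assoc]
        exact ENNReal.ofReal_le_ofReal (mul_le_mul_of_nonneg_right (hbound u)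
          (Real.rpow_nonneg (sub_pos.2 hux).le _))
    · rw [Set.indicator_of_notMem (show u ∉ Set.Iio x from hux)]
      exact zero_le
  set G : ℝ := (Real.Gamma d)⁻¹ * C with hG
  have hG0 : 0 ≤ G := by positivity
  refine ⟨G * (M₁ + M₂), by positivity, fun x ↦ ?_, fun x hx ↦ ?_⟩
  · have h := (key x).trans (mul_le_mul_right (hM₁ x) _)
    rw [← ENNReal.ofReal_coe_nnreal, ← ENNReal.ofReal_mul hG0,
      ENNReal.ofReal_le_ofReal_iff (by positivity)] at h
    refine h.trans (mul_le_mul_of_nonneg_left ?_ hG0)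
    linarith [M₂.2]
  · have hxp : 0 < x ^ (1 - d) := by positivity
    have h : ENNReal.ofReal (x ^ (1 - d)) * ENNReal.ofReal |leftFracIntegral d g x| ≤
        ENNReal.ofReal G * M₂ := by
      refine (mul_le_mul_right (key x) _).trans ?_
      rw [mul_left_comm]
      exact mul_le_mul_right (hM₂ x) _
    rw [← ENNReal.ofReal_coe_nnreal, ← ENNReal.ofReal_mul hG0, ← ENNReal.ofReal_mul hxp.le,
      ENNReal.ofReal_le_ofReal_iff (by positivity)] at h
    have hinv : x ^ (d - 1) = (x ^ (1 - d))⁻¹ := by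
      rw [← Real.rpow_neg hx.le, neg_sub]
    rw [hinv, ← div_eq_mul_inv, le_div_iff₀ hxp, mul_comm]
    refine h.trans (mul_le_mul_of_nonneg_left ?_ hG0)
    linarith [M₁.2]

/-- The moving average kernel `I_+^d g` restricted to the half-line is in `L^α`. -/
lemma IsShortMemoryKernel.memLp_leftFracIntegral {g : ℝ → ℝ} (hg : IsShortMemoryKernel g)
    {α d : ℝ} (hα : 1 < α) (hd : 0 < d) (hdα : d < 1 - 1 / α) :
    MemLp ((Set.Ici 0).indicator (leftFracIntegral d g)) (ENNReal.ofReal α) volume := by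
  have hα0 : 0 < α := by linarith
  have hd1 : d < 1 := hdα.trans (sub_lt_self 1 (by positivity))
  obtain ⟨M, hM0, hM1, hM2⟩ := hg.exists_abs_leftFracIntegral_le hd hd1
  have hB1 : MemLp ((Set.Icc (0 : ℝ) 1).indicator fun _ ↦ M) (ENNReal.ofReal α) volume :=
    memLp_indicator_const _ measurableSet_Icc _ (Or.inr (by simp))
  have hB2 : MemLp ((Set.Ioi (1 : ℝ)).indicator fun x ↦ M * x ^ (d - 1))
      (ENNReal.ofReal α) volume := by
    rw [memLp_indicator_iff_restrict measurableSet_Ioi]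
    refine MemLp.const_mul ?_ M
    rw [← integrable_norm_rpow_iff (by fun_prop) (by simpa using hα0) ENNReal.ofReal_ne_top,
      ENNReal.toReal_ofReal hα0.le]
    -- This is exactly the assumption `d < 1 - 1/α`.
    have hexp : (d - 1) * α < -1 := by
      have : d * α < (1 - 1 / α) * α := mul_lt_mul_of_pos_right hdα hα0
      rw [sub_mul, one_div_mul_cancel hα0.ne'] at this
      linarith
    have hint : IntegrableOn (fun x : ℝ ↦ x ^ ((d - 1) * α)) (Set.Ioi 1) :=
      integrableOn_Ioi_rpow_of_lt hexp one_pos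
    refine hint.congr_fun (fun x hx ↦ ?_) measurableSet_Ioi
    have hx0 : (0 : ℝ) < x := zero_lt_one.trans hx
    simp only
    rw [Real.norm_of_nonneg (by positivity), Real.rpow_mul hx0.le]
  refine (hB1.add hB2).mono' ((measurable_leftFracIntegral d hg.measurable).indicator
    measurableSet_Ici).aestronglyMeasurable (ae_of_all _ fun x ↦ ?_)
  rw [Pi.add_apply, Real.norm_eq_abs]
  rcases lt_or_ge x 0 with hx | hx
  · have h1 : x ∉ Set.Ici (0 : ℝ) := not_le.2 hx
    have h2 : x ∉ Set.Icc (0 : ℝ) 1 := fun h ↦ h1 h.1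
    have h3 : x ∉ Set.Ioi (1 : ℝ) := fun h ↦ h1 (Set.mem_Ici.2 (zero_le_one.trans (Set.mem_Ioi.1 h).le))
    simp [Set.indicator_of_notMem, h1, h2, h3]
  · rw [Set.indicator_of_mem (show x ∈ Set.Ici (0 : ℝ) from hx)]
    rcases le_or_gt x 1 with hx1 | hx1
    · rw [Set.indicator_of_mem (show x ∈ Set.Icc (0 : ℝ) 1 from ⟨hx, hx1⟩),
        Set.indicator_of_notMem (show x ∉ Set.Ioi (1 : ℝ) from not_lt.2 hx1), add_zero]
      exact hM1 x
    · rw [Set.indicator_of_notMem (fun h : x ∈ Set.Icc (0 : ℝ) 1 ↦ absurd h.2 (not_le.2 hx1)),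
        Set.indicator_of_mem (show x ∈ Set.Ioi (1 : ℝ) from hx1), zero_add]
      exact hM2 x (by linarith)

/-! ### Averages of translates along the sampling times. -/

/-- The average `n⁻¹ ∑_{j=1}^n h(t_j - x)` of translates of `h`. -/
noncomputable def translateAverage (h : ℝ → ℝ) (t : ℕ → ℝ) (n : ℕ) (x : ℝ) : ℝ :=
  (∑ j ∈ Finset.Icc 1 n, h (t j - x)) / n

lemma translateAverage_eq_smul (h : ℝ → ℝ) (t : ℕ → ℝ) (n : ℕ) :
    translateAverage h t n = (n : ℝ)⁻¹ • ∑ j ∈ Finset.Icc 1 n, fun x ↦ h (t j - x) := by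
  funext x
  simp [translateAverage, div_eq_inv_mul]

lemma aestronglyMeasurable_comp_sub_left {h : ℝ → ℝ} (hh : AEStronglyMeasurable h volume) (s : ℝ) :
    AEStronglyMeasurable (fun x ↦ h (s - x)) volume :=
  hh.comp_measurePreserving (Measure.measurePreserving_sub_left volume s)

lemma eLpNorm_comp_sub_left {h : ℝ → ℝ} (hh : AEStronglyMeasurable h volume) (q : ENNReal)
    (s : ℝ) : eLpNorm (fun x ↦ h (s - x)) q volume = eLpNorm h q volume :=
  eLpNorm_comp_measurePreserving hh (Measure.measurePreserving_sub_left volume s)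

lemma aestronglyMeasurable_translateAverage {h : ℝ → ℝ} (hh : AEStronglyMeasurable h volume)
    (t : ℕ → ℝ) (n : ℕ) : AEStronglyMeasurable (translateAverage h t n) volume := by
  rw [translateAverage_eq_smul]
  exact (Finset.aestronglyMeasurable_sum _ fun j _ ↦
    aestronglyMeasurable_comp_sub_left hh (t j)).const_smul _

lemma eLpNorm_translateAverage_le {h : ℝ → ℝ} (hh : AEStronglyMeasurable h volume) {q : ENNReal}
    (hq : 1 ≤ q) (t : ℕ → ℝ) (n : ℕ) :
    eLpNorm (translateAverage h t n) q volume ≤ eLpNorm h q volume := by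
  rw [translateAverage_eq_smul, eLpNorm_const_smul]
  rcases Nat.eq_zero_or_pos n with rfl | hn
  · simp
  refine (mul_le_mul_right (eLpNorm_sum_le (fun j _ ↦
    aestronglyMeasurable_comp_sub_left hh (t j)) hq) _).trans ?_
  simp_rw [eLpNorm_comp_sub_left hh]
  rw [Finset.sum_const, Nat.card_Icc, Nat.add_sub_cancel, nsmul_eq_mul, ← mul_assoc,
    Real.enorm_eq_ofReal (by positivity), ENNReal.ofReal_inv_of_pos (by positivity),
    ENNReal.ofReal_natCast, ENNReal.inv_mul_cancel (by simpa using hn.ne') (by simp), one_mul]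

/-- If `t_j ∼ ℓ j^β`, then `|t_j - ℓ j^β| ≤ η j^β + D` for all `j ≥ 1`. -/
lemma exists_abs_sub_le_of_tendsto {t : ℕ → ℝ} {β ℓ η : ℝ} (hη : 0 < η)
    (ht : Tendsto (fun j : ℕ ↦ (j : ℝ) ^ (-β) * t j) atTop (𝓝 ℓ)) :
    ∃ D : ℝ, 0 ≤ D ∧ ∀ j : ℕ, 1 ≤ j → |t j - ℓ * (j : ℝ) ^ β| ≤ η * (j : ℝ) ^ β + D := by
  obtain ⟨J, hJ⟩ := Metric.tendsto_atTop.1 ht η hη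
  -- The finitely many early deviations are absorbed in their sum.
  refine ⟨∑ j ∈ Finset.range J, |t j - ℓ * (j : ℝ) ^ β|, Finset.sum_nonneg fun _ _ ↦ abs_nonneg _,
    fun j hj ↦ ?_⟩
  have hj0 : (0 : ℝ) < j := by exact_mod_cast hj
  have hjβ : 0 < (j : ℝ) ^ β := by positivity
  rcases lt_or_ge j J with h | h
  · have := Finset.single_le_sum (f := fun j : ℕ ↦ |t j - ℓ * (j : ℝ) ^ β|)
      (fun _ _ ↦ abs_nonneg _) (Finset.mem_range.2 h)
    have : 0 ≤ η * (j : ℝ) ^ β := by positivity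
    linarith
  · have h1 := (hJ j h).le
    rw [Real.dist_eq] at h1
    have h2 : t j - ℓ * (j : ℝ) ^ β = (j : ℝ) ^ β * ((j : ℝ) ^ (-β) * t j - ℓ) := by
      rw [mul_sub, ← mul_assoc, ← Real.rpow_add hj0, add_neg_cancel, Real.rpow_zero]
      ring
    rw [h2, abs_mul, abs_of_pos hjβ, mul_comm]
    have h3 : 0 ≤ ∑ j ∈ Finset.range J, |t j - ℓ * (j : ℝ) ^ β| :=
      Finset.sum_nonneg fun _ _ ↦ abs_nonneg _
    nlinarith

/-- If `t_j ∼ ℓ j^β`, then windows of fixed length contain `o(n)` of the times `t_1, …, t_n`,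
uniformly in the position of the window. -/
lemma eventually_card_window_le {t : ℕ → ℝ} {β ℓ : ℝ} (hβ : 0 < β) (hℓ : 0 < ℓ)
    (ht : Tendsto (fun j : ℕ ↦ (j : ℝ) ^ (-β) * t j) atTop (𝓝 ℓ)) (R : ℝ) {ε : ℝ} (hε : 0 < ε)
    (hε1 : ε < 1) :
    ∀ᶠ n : ℕ in atTop, ∀ x : ℝ,
      (((Finset.Icc 1 n).filter fun j ↦ |t j - x| ≤ R).card : ℝ) ≤ ε * n + 1 := by
  set ρ : ℝ := (1 - ε) ^ β with hρ
  have hρ1 : ρ < 1 := Real.rpow_lt_one (by linarith) (by linarith) hβ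
  have hρ0 : 0 ≤ ρ := Real.rpow_nonneg (by linarith) _
  -- If the extreme indices `j < k` of a window satisfy `j ≤ (1 - ε) k`, then `t_k - t_j` is at
  -- least `(4η - 2η) k^β - 2D`. As it is at most `2R`, this bounds `η k^β` by `R + D`, which fails
  -- for large `n` because `k ≥ ε n`.
  set η : ℝ := ℓ * (1 - ρ) / 4 with hη
  have hη0 : 0 < η := by
    have : 0 < 1 - ρ := by linarith
    positivity
  obtain ⟨D, hD, htD⟩ := exists_abs_sub_le_of_tendsto hη0 ht
  have hlim : Tendsto (fun n : ℕ ↦ (ε * (n : ℝ)) ^ β) atTop atTop :=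
    (tendsto_rpow_atTop hβ).comp (tendsto_natCast_atTop_atTop.const_mul_atTop hε)
  filter_upwards [hlim.eventually_gt_atTop ((R + D) / η)] with n hn x
  rw [div_lt_iff₀ hη0] at hn
  set A := (Finset.Icc 1 n).filter fun j ↦ |t j - x| ≤ R with hA
  rcases A.eq_empty_or_nonempty with h | h
  · rw [h]
    simp only [Finset.card_empty, Nat.cast_zero]
    positivity
  set j := A.min' h
  set k := A.max' h
  have hjA : j ∈ A := A.min'_mem h
  have hkA : k ∈ A := A.max'_mem h
  have hjk : j ≤ k := A.min'_le k hkA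
  have hcard : A.card ≤ k + 1 - j := by
    rw [← Nat.card_Icc]
    exact Finset.card_le_card fun i hi ↦ Finset.mem_Icc.2 ⟨A.min'_le i hi, A.le_max' i hi⟩
  have hcard' : (A.card : ℝ) + j ≤ k + 1 := by exact_mod_cast (by omega : A.card + j ≤ k + 1)
  rw [hA, Finset.mem_filter, Finset.mem_Icc] at hjA hkA
  by_contra! hcon
  have hgap : (j : ℝ) ≤ k - ε * n := by linarith
  have hj1 : (1 : ℝ) ≤ j := by exact_mod_cast hjA.1.1
  have hkn : (k : ℝ) ≤ n := by exact_mod_cast hkA.1.2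
  have hk0 : (0 : ℝ) ≤ k := k.cast_nonneg
  have hjk' : (j : ℝ) ≤ (1 - ε) * k := by nlinarith
  have hjβ : (j : ℝ) ^ β ≤ ρ * (k : ℝ) ^ β := by
    rw [hρ, ← Real.mul_rpow (by linarith) hk0]
    exact Real.rpow_le_rpow (by linarith) hjk' hβ.le
  have hkβ : (ε * (n : ℝ)) ^ β ≤ (k : ℝ) ^ β :=
    Real.rpow_le_rpow (by positivity) (by linarith) hβ.le
  have h1 := abs_le.1 (htD j hjA.1.1)
  have h2 := abs_le.1 (htD k hkA.1.1)
  have h3 := abs_le.1 hjA.2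
  have h4 := abs_le.1 hkA.2
  have hηρ : ℓ - ℓ * ρ = 4 * η := by rw [hη]; ring
  have hkβ0 : 0 ≤ (k : ℝ) ^ β := by positivity
  have h5 : (ℓ + η) * (j : ℝ) ^ β ≤ (ℓ + η) * (ρ * (k : ℝ) ^ β) :=
    mul_le_mul_of_nonneg_left hjβ (by linarith)
  have h6 : η * ρ * (k : ℝ) ^ β ≤ η * (k : ℝ) ^ β := by
    refine mul_le_mul_of_nonneg_right ?_ hkβ0
    nlinarith
  have h7 : (ℓ - ℓ * ρ) * (k : ℝ) ^ β = 4 * η * (k : ℝ) ^ β := by rw [hηρ]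
  have h8 := mul_le_mul_of_nonneg_left hkβ hη0.le
  nlinarith

/-- Interpolation of the `L^α` norm between a uniform bound and the `L^1` norm. -/
lemma eLpNorm_le_of_enorm_le {F : ℝ → ℝ} {α : ℝ} (hα : 1 < α) {b : ENNReal} (hb : b ≠ ⊤)
    (hF : ∀ x, ‖F x‖ₑ ≤ b) :
    eLpNorm F (ENNReal.ofReal α) volume ≤
      (b ^ (α - 1) * eLpNorm F 1 volume) ^ (1 / α) := by
  have hα0 : 0 < α := by linarith
  rw [eLpNorm_eq_lintegral_rpow_enorm_toReal (by simpa using hα0) ENNReal.ofReal_ne_top,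
    ENNReal.toReal_ofReal hα0.le, eLpNorm_one_eq_lintegral_enorm]
  refine ENNReal.rpow_le_rpow ?_ (by positivity)
  rw [← lintegral_const_mul' _ _ (ENNReal.rpow_ne_top_of_nonneg (by linarith) hb)]
  refine lintegral_mono fun x ↦ ?_
  have hsplit : ‖F x‖ₑ ^ α = ‖F x‖ₑ ^ (α - 1) * ‖F x‖ₑ := by
    conv_rhs => rw [← ENNReal.rpow_one ‖F x‖ₑ, ← ENNReal.rpow_mul, one_mul]
    rw [← ENNReal.rpow_add_of_nonneg _ _ (by linarith) zero_le_one, sub_add_cancel]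
  rw [hsplit]
  gcongr
  exact hF x

/-- Only the `o(n)` times within `R` of `x` contribute to the average at `x`, so its sup norm tends
to zero while its `L^1` norm stays bounded; interpolate. -/
lemma tendsto_eLpNorm_translateAverage_of_bounded {k : ℝ → ℝ} {α β ℓ B R : ℝ} (hα : 1 < α)
    (hβ : 0 < β) (hℓ : 0 < ℓ) {t : ℕ → ℝ}
    (ht : Tendsto (fun j : ℕ ↦ (j : ℝ) ^ (-β) * t j) atTop (𝓝 ℓ))
    (hk : MemLp k 1 volume) (hB : ∀ x, |k x| ≤ B) (hR : ∀ x, R < |x| → k x = 0) :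
    Tendsto (fun n ↦ eLpNorm (translateAverage k t n) (ENNReal.ofReal α) volume) atTop (𝓝 0) := by
  have hα0 : 0 < α := by linarith
  have hB0 : 0 ≤ B := (abs_nonneg _).trans (hB 0)
  set N := eLpNorm k 1 volume with hN
  have hN' : N ≠ ⊤ := hk.2.ne
  rw [ENNReal.tendsto_atTop_zero]
  intro ε hε
  -- The `2 δ` bounds `(δ n + 1) / n` once `n ≥ 1 / δ`.
  obtain ⟨δ, hδ0, hδ1, hδε⟩ : ∃ δ : ℝ, 0 < δ ∧ δ < 1 ∧
      (ENNReal.ofReal (B * (2 * δ)) ^ (α - 1) * N) ^ (1 / α) ≤ ε := by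
    have hlim : Tendsto (fun δ : ℝ ↦ (ENNReal.ofReal (B * (2 * δ)) ^ (α - 1) * N) ^ (1 / α))
        (𝓝[>] 0) (𝓝 ((ENNReal.ofReal (B * (2 * 0)) ^ (α - 1) * N) ^ (1 / α))) := by
      refine (ENNReal.continuous_rpow_const.tendsto _).comp ?_
      refine ENNReal.Tendsto.mul_const ?_ (Or.inr hN')
      refine (ENNReal.continuous_rpow_const.tendsto _).comp ?_
      refine ENNReal.tendsto_ofReal ?_
      have : Continuous fun δ : ℝ ↦ B * (2 * δ) := by fun_prop
      exact (this.tendsto 0).mono_left nhdsWithin_le_nhds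
    rw [mul_zero, mul_zero, ENNReal.ofReal_zero, ENNReal.zero_rpow_of_pos (by linarith), zero_mul,
      ENNReal.zero_rpow_of_pos (by positivity)] at hlim
    obtain ⟨δ, h1, h2⟩ := (((tendsto_order.1 hlim).2 ε hε).and
      (Ioo_mem_nhdsGT one_pos)).exists
    exact ⟨δ, h2.1, h2.2, h1.le⟩
  obtain ⟨n₀, hn₀⟩ := eventually_atTop.1 ((eventually_card_window_le hβ hℓ ht R hδ0 hδ1).and
    (tendsto_natCast_atTop_atTop.eventually_ge_atTop (1 / δ)))
  refine ⟨n₀, fun n hn ↦ ?_⟩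
  obtain ⟨hcard, hnδ⟩ := hn₀ n hn
  rw [div_le_iff₀ hδ0] at hnδ
  have hn0 : (0 : ℝ) < n := by
    by_contra! h
    nlinarith
  have hbound : ∀ x, ‖translateAverage k t n x‖ₑ ≤ ENNReal.ofReal (B * (2 * δ)) := fun x ↦ by
    rw [Real.enorm_eq_ofReal_abs]
    refine ENNReal.ofReal_le_ofReal ?_
    rw [translateAverage, abs_div, abs_of_pos hn0, div_le_iff₀ hn0]
    calc |∑ j ∈ Finset.Icc 1 n, k (t j - x)|
        = |∑ j ∈ (Finset.Icc 1 n).filter (fun j ↦ |t j - x| ≤ R), k (t j - x)| := by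
          congr 1
          rw [Finset.sum_filter]
          refine Finset.sum_congr rfl fun j _ ↦ ?_
          split_ifs with h
          · rfl
          · exact hR _ (not_le.1 h)
      _ ≤ ∑ j ∈ (Finset.Icc 1 n).filter (fun j ↦ |t j - x| ≤ R), B :=
          (Finset.abs_sum_le_sum_abs _ _).trans (Finset.sum_le_sum fun j _ ↦ hB _)
      _ = ((Finset.Icc 1 n).filter (fun j ↦ |t j - x| ≤ R)).card * B := by
          rw [Finset.sum_const, nsmul_eq_mul]
      _ ≤ (δ * n + 1) * B := mul_le_mul_of_nonneg_right (hcard x) hB0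
      _ ≤ B * (2 * δ) * n := by nlinarith
  refine (eLpNorm_le_of_enorm_le hα ENNReal.ofReal_ne_top hbound).trans (le_trans ?_ hδε)
  gcongr
  exact eLpNorm_translateAverage_le hk.1 le_rfl t n

/-- If `t_j ∼ ℓ j^β` with `ℓ, β > 0`, then the averages of the translates of `h ∈ L^α`, `α > 1`,
along `t_j` converge to zero in `L^α`. -/
lemma tendsto_eLpNorm_translateAverage {h : ℝ → ℝ} {α β ℓ : ℝ} (hα : 1 < α)
    (hβ : 0 < β) (hℓ : 0 < ℓ) {t : ℕ → ℝ}
    (ht : Tendsto (fun j : ℕ ↦ (j : ℝ) ^ (-β) * t j) atTop (𝓝 ℓ))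
    (hh : MemLp h (ENNReal.ofReal α) volume) :
    Tendsto (fun n ↦ eLpNorm (translateAverage h t n) (ENNReal.ofReal α) volume) atTop (𝓝 0) := by
  rw [ENNReal.tendsto_atTop_zero]
  intro ε hε
  have hε2 : 0 < ε / 2 := ENNReal.half_pos hε.ne'
  have hα1 : 1 ≤ ENNReal.ofReal α := by simpa using hα.le
  obtain ⟨k, hksupp, hkh, hkc, hkm⟩ := hh.exists_hasCompactSupport_eLpNorm_sub_le
    ENNReal.ofReal_ne_top hε2.ne'
  obtain ⟨R, hR⟩ := hksupp.isCompact.isBounded.exists_norm_le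
  obtain ⟨B, hB⟩ := hksupp.exists_bound_of_continuous hkc
  have hk := tendsto_eLpNorm_translateAverage_of_bounded hα hβ hℓ ht
    (memLp_one_iff_integrable.2 (hkc.integrable_of_hasCompactSupport hksupp)) hB (R := R)
    fun x hx ↦ image_eq_zero_of_notMem_tsupport fun hxs ↦ absurd (hR x hxs) (not_le.2 hx)
  obtain ⟨n₀, hn₀⟩ := ENNReal.tendsto_atTop_zero.1 hk (ε / 2) hε2
  refine ⟨n₀, fun n hn ↦ ?_⟩
  have hsplit : translateAverage h t n = translateAverage (h - k) t n + translateAverage k t n := by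
    funext x
    simp [translateAverage, ← add_div]
  rw [hsplit, ← ENNReal.add_halves ε]
  refine (eLpNorm_add_le (aestronglyMeasurable_translateAverage (hh.1.sub hkm.1) t n)
    (aestronglyMeasurable_translateAverage hkm.1 t n) hα1).trans (add_le_add ?_ (hn₀ n hn))
  exact (eLpNorm_translateAverage_le (hh.1.sub hkm.1) hα1 t n).trans hkh

/-! ### Sample means as stable integrals, and the conclusion. -/

/-- The integrand of `Y_d(s)` is the translate by `s` of the reflected kernel. -/
lemma indicator_Iic_leftFracIntegral (d : ℝ) (g : ℝ → ℝ) (s : ℝ) :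
    (Set.Iic s).indicator (fun x ↦ leftFracIntegral d g (s - x)) =
      fun x ↦ (Set.Ici 0).indicator (leftFracIntegral d g) (s - x) := by
  funext x
  simp only [Set.indicator_apply, Set.mem_Iic, Set.mem_Ici, sub_nonneg]

lemma IsFIMAProcess.isStableLpLimit_average {Ω : Type*} [MeasurableSpace Ω] {P : Measure Ω}
    [IsProbabilityMeasure P] {α d p : ℝ} {g : ℝ → ℝ} {L Y : ℝ → Ω → ℝ}
    (hL : IsStableMotion P α L) (hp : 1 ≤ p) (hpα : p < α) (hY : IsFIMAProcess P α d g L Y)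
    (t : ℕ → ℝ) (n : ℕ) :
    IsStableLpLimit P α p L (translateAverage ((Set.Ici 0).indicator (leftFracIntegral d g)) t n)
      (fun ω ↦ partialSum Y t n ω / n) := by
  have hα : 1 ≤ α := hp.trans hpα.le
  have hsum : ∀ s : Finset ℕ, IsStableLpLimit P α p L
      (∑ j ∈ s, fun x ↦ (Set.Ici 0).indicator (leftFracIntegral d g) (t j - x))
      (∑ j ∈ s, Y (t j)) := fun s ↦ by
    classical
    induction s using Finset.induction_on with
    | empty => simpa using IsStableLpLimit.zero P α p L
    | insert j s hj ih =>
      rw [Finset.sum_insert hj, Finset.sum_insert hj]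
      have hYj := hY (t j)
      rw [indicator_Iic_leftFracIntegral] at hYj
      simpa using (hYj.isStableLpLimit hL hp hpα).linear_combination hL hp hα ih 1 1
  -- Scalar multiplication by `n⁻¹`, with zero as a dummy second summand.
  have h := (hsum (Finset.Icc 1 n)).linear_combination hL hp hα
    (IsStableLpLimit.zero P α p L) (n : ℝ)⁻¹ 0
  rw [smul_zero, add_zero, smul_zero, add_zero] at h
  rw [translateAverage_eq_smul]
  convert h using 1
  funext ω
  simp [partialSum, div_eq_inv_mul]

end FIMA

theorem corollary4p1 {Ω : Type*} [MeasurableSpace Ω] (P : Measure Ω) [IsProbabilityMeasure P]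
    (α d p : ℝ) (hα₁ : 1 < α) (hα₂ : α < 2) (hd₀ : 0 < d) (hd₁ : d < 1 - 1 / α)
    (hp₁ : 1 ≤ p) (hp₂ : p < α)
    (L : ℝ → Ω → ℝ) (hL : FIMA.IsStableMotion P α L)
    (g : ℝ → ℝ) (hg : FIMA.IsShortMemoryKernel g)
    (t : ℕ → ℝ) (a : ℝ) (hta : ∀ j, 1 ≤ j → a ≤ t j)
    (β K ℓ : ℝ) (hβ : 0 < β) (hK : 0 < K) (hℓ : K ≤ ℓ)
    (ht : Tendsto (fun j : ℕ => (j : ℝ) ^ (-β) * t j) atTop (𝓝 ℓ)) :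
    (∃ Y : ℝ → Ω → ℝ, FIMA.IsFIMAProcess P α d g L Y) ∧
    ∀ Y : ℝ → Ω → ℝ, FIMA.IsFIMAProcess P α d g L Y →
      (∀ n : ℕ, MemLp (fun ω => FIMA.partialSum Y t n ω / n) (ENNReal.ofReal p) P) ∧
      Tendsto (fun n : ℕ =>
          eLpNorm (fun ω => FIMA.partialSum Y t n ω / n) (ENNReal.ofReal p) P)
        atTop (𝓝 0) := by
  have hkernel := hg.memLp_leftFracIntegral hα₁ hd₀ hd₁
  constructor
  · have hex : ∀ s : ℝ, ∃ X : Ω → ℝ, FIMA.IsStableIntegral P α L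
        ((Set.Iic s).indicator (fun x => FIMA.leftFracIntegral d g (s - x))) X := fun s ↦ by
      refine hL.exists_isStableIntegral hα₁ ?_
      rw [FIMA.indicator_Iic_leftFracIntegral]
      exact hkernel.comp_measurePreserving (Measure.measurePreserving_sub_left volume s)
    choose Y hY using hex
    exact ⟨Y, hY⟩
  · intro Y hY
    obtain ⟨C, hC⟩ := hL.exists_eLpNorm_le_of_isStableLpLimit hp₁ hp₂
    have hlim := fun n ↦ hY.isStableLpLimit_average hL hp₁ hp₂ t n
    have hbound := fun n ↦ hC _ _ (hlim n)
    refine ⟨fun n ↦ ⟨(hlim n).aestronglyMeasurable, (hbound n).trans_lt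
      (ENNReal.mul_lt_top ENNReal.coe_lt_top (hlim n).memLp.2)⟩, ?_⟩
    have h0 := ENNReal.Tendsto.const_mul (a := (C : ENNReal))
      (FIMA.tendsto_eLpNorm_translateAverage hα₁ hβ (hK.trans_le hℓ) ht hkernel)
      (Or.inr ENNReal.coe_ne_top)
    rw [mul_zero] at h0
    exact tendsto_of_tendsto_of_tendsto_of_le_of_le tendsto_const_nhds h0 (fun _ ↦ zero_le) hbound
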